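/- **Setting.** A multi-play bandit with prioritized resource sharing (MSB-PRS) has $M$ arms and $K$ plays. Play $k$ has a weight $\alpha_k$, with $\alpha_1\ge\dots\ge\alpha_K>0$, and movement costs $c_{k,m}\in[0,+\infty]$ (each play has at least one arm of finite cost). Arm $m$ has a capacity law $D_m$ supported in $\{1,\dots,d_{\max}\}$ and a $\sigma$-subgaussian per-unit reward law $R_m$ with mean $\mu_m>0$. In every round the decision maker assigns each play $k$ to an arm $a_k\in\{1,\dots,M\}$; independent capacities $D_m$ and per-unit rewards $R_{m,i}\sim R_m$ are drawn, independently over rounds. If $\ell_k$ is the rank of play $k$ by weight (ties broken by index) among the plays assigned to the same arm, then play $k$ receives $X_k=\alpha_k R_{a_k,\ell_k}$ if $\ell_k\le D_{a_k}$ and "null" otherwise. The decision maker observes all $X_k$, and $D_m$ for exactly those arms to which some play is assigned. The utility of an action profile $a=(a_k)_k$ is $$U(a)=\sum_{m=1}^M\Big(\mu_m\sum_{k:\,a_k=m}\alpha_k\,\mathbb P[D_m\ge \ell_k]-\sum_{k:\,a_k=m}c_{k,m}\Big),$$ and, with $a^*$ a maximizer of $U$, the regret is $\mathrm{Reg}_T=\mathbb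 E\big[\sum_{t=1}^T (U(a^*)-U(a^{(t)}))\big]$. An algorithm knows $M,K,\alpha,c,d_{\max}$, but not the laws $D_m,R_m$, and chooses each $a^{(t)}$, possibly at random, from the past action profiles and observations. It is consistent on a class of instances if on each of them $\mathrm{Reg}_T=o(T^p)$ for every $p>0$. The $\Delta$-gap class consists of the instances, for the given $M$, $K$, $\sigma$, with $$U(a^*)-\max_{a:\,U(a)\ne U(a^*)}U(a)=\Delta .$$ **Theorem.** Let $M\ge 2$, $K\ge 1$, $\sigma\ge 0$ and $\Delta>0$. 1. For every $w\ge 4$ there is an instance of the $\Delta$-gap class with largest weight $\alpha_1=w$ on which every algorithm that is consistent on the $\Delta$-gap class satisfies $$\liminf_{T\to\infty}\frac{\mathrm{Reg}_T}{\ln T}\ \ge\ \alpha_1\sigma^2\frac{M}{\Delta}.$$ 2. For every $w\ge 1$ there is an instance of the $\Delta$-gap class with $\alpha_1=w$ on which every algorithm that is consistent on the class of all instances (with the given $M$, $K$, $\sigma$ and any utility gap) satisfies the same inequality. -/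

import Mathlib

open MeasureTheory ProbabilityTheory Filter
open scoped NNReal ENNReal Topology

namespace MSBPRS

/-- What the decision maker knows in advance: the priority weights of the `K` plays, the movement
costs (`⊤` means that the arm is unavailable to the play) and the bound on the capacities.
Play `1` of the usual numbering is the index `0`. -/
structure PublicData (M K : ℕ) where
  weight : Fin K → ℝ
  weight_pos : ∀ k, 0 < weight k
  weight_anti : Antitone weight
  cost : Fin K → Fin M → ℝ≥0∞
  /-- Every play has at least one available arm. -/
  exists_available : ∀ k, ∃ m, cost k m ≠ ⊤
  dMax : ℕ

/-- An instance with `M` arms, `K` plays and `σ`-subgaussian per-unit rewards: the public data and,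
for each arm, the (unknown) laws of its capacity and of its per-unit reward. -/
structure Instance (M K : ℕ) (σ : ℝ≥0) extends PublicData M K where
  capacity : Fin M → PMF ℕ
  capacity_support : ∀ m, (capacity m).support ⊆ Set.Icc 1 dMax
  reward : Fin M → Measure ℝ
  reward_prob : ∀ m, IsProbabilityMeasure (reward m)
  reward_mean_pos : ∀ m, 0 < ∫ x, x ∂(reward m)
  reward_subgaussian :
    ∀ m, HasSubgaussianMGF (fun x => x - ∫ y, y ∂(reward m)) (σ ^ 2) (reward m)

/-- An action profile assigns an arm to every play. -/
abbrev Action (M K : ℕ) : Type := Fin K → Fin M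

/-- The feedback of a round: the rewards of the plays, and the capacities of the arms.
`Sum.inr ()` stands for `null` (no reward), respectively for a capacity that is not revealed. -/
abbrev Feedback (M K : ℕ) : Type := (Fin K → ℝ ⊕ Unit) × (Fin M → ℕ ⊕ Unit)

/-- A round as recorded by the decision maker: the action profile and the feedback. -/
abbrev Round (M K : ℕ) : Type := Action M K × Feedback M K

/-- The randomness of a round: the capacity of each arm, and the rewards of its capacity units
(at most `K` units of an arm can be used in a round). -/
abbrev Draw (M K : ℕ) : Type := (Fin M → ℕ) × (Fin M → Fin K → ℝ)

section Model

variable {M K : ℕ} {σ : ℝ≥0}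

/-- The rank (counted from `1`) of play `k` among the plays assigned to its arm, in descending
order of weight; as the weights are sorted, this is the order of the indices, which also
breaks ties. -/
def rank (a : Action M K) (k : Fin K) : ℕ :=
  (Finset.univ.filter fun j => j ≤ k ∧ a j = a k).card

theorem rank_pred_lt (a : Action M K) (k : Fin K) : rank a k - 1 < K := by
  have h : rank a k ≤ K := by
    simpa [rank] using Finset.card_le_univ (Finset.univ.filter fun j => j ≤ k ∧ a j = a k)
  have := k.pos
  omega

/-- The reward observed by play `k`: its weight times the reward of the unit of capacity that it
occupies, or `null` if its rank exceeds the capacity of its arm. -/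
noncomputable def playReward (P : PublicData M K) (a : Action M K) (z : Draw M K) (k : Fin K) :
    ℝ ⊕ Unit :=
  if rank a k ≤ z.1 (a k) then
    Sum.inl (P.weight k * z.2 (a k) ⟨rank a k - 1, rank_pred_lt a k⟩)
  else Sum.inr ()

open Classical in
/-- The capacity of arm `m` is revealed if and only if some play is assigned to `m`. -/
noncomputable def capacityFeedback (a : Action M K) (z : Draw M K) (m : Fin M) : ℕ ⊕ Unit :=
  if ∃ k, a k = m then Sum.inl (z.1 m) else Sum.inr ()

/-- The feedback of a round in which the action profile `a` is played. -/
noncomputable def feedback (P : PublicData M K) (a : Action M K) (z : Draw M K) : Feedback M K :=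
  (playReward P a z, capacityFeedback a z)

theorem measurable_feedback (P : PublicData M K) (a : Action M K) :
    Measurable (feedback P a) := by
  refine Measurable.prodMk (measurable_pi_lambda _ fun k => ?_)
    (measurable_pi_lambda _ fun m => ?_)
  · refine Measurable.ite ?_ (measurable_inl.comp (by fun_prop)) measurable_const
    exact measurableSet_le measurable_const (by fun_prop)
  · by_cases h : ∃ k, a k = m
    · simp only [capacityFeedback, if_pos h]
      exact measurable_inl.comp (by fun_prop)
    · simp only [capacityFeedback, if_neg h]
      exact measurable_const

namespace Instance

variable (I : Instance M K σ)

/-- In a round, all capacities and all per-unit rewards are independent. -/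
noncomputable def drawLaw : Measure (Draw M K) :=
  (Measure.pi fun m => (I.capacity m).toMeasure).prod
    (Measure.pi fun m => Measure.pi fun _ : Fin K => I.reward m)

instance : IsProbabilityMeasure I.drawLaw := by
  have := I.reward_prob
  unfold drawLaw
  infer_instance

/-- The law of the feedback of a round, given the action profile of the round. -/
noncomputable def feedbackKernel : Kernel (Action M K) (Feedback M K) :=
  Kernel.ofFunOfCountable fun a => I.drawLaw.map (feedback I.toPublicData a)

instance : IsMarkovKernel I.feedbackKernel :=
  ⟨fun a => Measure.isProbabilityMeasure_map (measurable_feedback I.toPublicData a).aemeasurable⟩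

/-- The mean per-unit reward of arm `m`. -/
noncomputable def mean (m : Fin M) : ℝ := ∫ x, x ∂(I.reward m)

/-- The probability that the capacity of arm `m` is at least `d`. -/
noncomputable def tail (m : Fin M) (d : ℕ) : ℝ := (I.capacity m).toMeasure.real {n | d ≤ n}

/-- The expected total reward generated from arm `m` under the action profile `a`. -/
noncomputable def armReward (a : Action M K) (m : Fin M) : ℝ :=
  I.mean m * ∑ k, if a k = m then I.weight k * I.tail m (rank a k) else 0

/-- The expected utility of arm `m`: expected reward minus movement costs. -/
noncomputable def armUtility (a : Action M K) (m : Fin M) : EReal :=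
  (I.armReward a m : EReal) - ((∑ k, if a k = m then I.cost k m else 0 : ℝ≥0∞) : EReal)

/-- The aggregate utility of an action profile (`⊥` if it uses an unavailable arm). -/
noncomputable def utility (a : Action M K) : EReal := ∑ m, I.armUtility a m

/-- The optimal utility (a maximum over finitely many action profiles). -/
noncomputable def optUtility : EReal := ⨆ a, I.utility a

/-- The utility gap: the optimal utility minus the largest utility different from it
(`⊤` if there is no other utility). -/
noncomputable def utilityGap : EReal :=
  I.optUtility - ⨆ a, ⨆ (_ : I.utility a ≠ I.optUtility), I.utility a

end Instance

/-- A possibly randomized policy: the law of the first action profile, and the conditional law of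
each later one given all action profiles and feedback of the rounds before it. -/
structure Policy (M K : ℕ) where
  first : Measure (Action M K)
  first_prob : IsProbabilityMeasure first
  next : (n : ℕ) → Kernel (Finset.Iic n → Round M K) (Action M K)
  next_markov : ∀ n, IsMarkovKernel (next n)

/-- A play allocation algorithm chooses its policy with knowledge of the public data only. -/
abbrev Algorithm (M K : ℕ) : Type := PublicData M K → Policy M K

/-- The law of the infinite sequence of rounds `0, 1, 2, …` when the policy `π` is run on `I`. -/
noncomputable def processLaw (I : Instance M K σ) (π : Policy M K) :
    Measure (ℕ → Round M K) :=
  have := π.next_markov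
  Kernel.trajMeasure (X := fun _ => Round M K) (π.first ⊗ₘ I.feedbackKernel)
    (fun n => π.next n ⊗ₖ I.feedbackKernel.prodMkLeft _)

/-- The regret of the algorithm `A` on `I` in the first `T` rounds. The summands are nonnegative;
they are infinite where an unavailable arm is used. -/
noncomputable def regret (A : Algorithm M K) (I : Instance M K σ) (T : ℕ) : ℝ≥0∞ :=
  ∫⁻ ω, ∑ t ∈ Finset.range T, (I.optUtility - I.utility (ω t).1).toENNReal
    ∂(processLaw I (A I.toPublicData))

/-- `A` is consistent on a class of instances: on each of them its regret is `o(T ^ p)` for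
every `p > 0`. -/
def ConsistentOn (A : Algorithm M K) (C : Set (Instance M K σ)) : Prop :=
  ∀ I ∈ C, ∀ p : ℝ, 0 < p →
    Tendsto (fun T : ℕ => regret A I T / ENNReal.ofReal ((T : ℝ) ^ p)) atTop (𝓝 0)

/-- The class of instances whose utility gap is `Δ`. -/
def gapClass (M K : ℕ) (σ : ℝ≥0) (Δ : ℝ) : Set (Instance M K σ) :=
  {I | I.utilityGap = (Δ : EReal)}

end Model

end MSBPRS

/-!
The lower bound is the change-of-measure argument of Lai and Robbins, on instances in which the
plays do not compete: all weights are `w`, movements are free, every arm has capacity `K`, and the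
per-unit rewards are Gaussian with variance `σ ^ 2`. The utility is then `w` times the sum of the
means of the arms of the plays, and the feedback of a round consists of one independent Gaussian
reward per play (`feedbackKernel_gaussianInstance`). In the hard instance arm `0` has mean
`1 + Δ / w` and all other arms have mean `1`, so that each play on a suboptimal arm costs exactly
`Δ`, and the utility gap is `Δ`.

For a suboptimal arm `m`, let the alternative instance raise the mean of arm `m` by some
`δ > Δ / w`, so that `m` becomes the best arm. As the public data do not change, the algorithm runs
the same policy on both instances, and the likelihood ratio of the histories is the product of the
Gaussian likelihood ratios of the plays on arm `m` (`lintegral_processLaw_of_density`). Each such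
play gives information `δ ^ 2 / (2 σ ^ 2)` (`integral_roundLLR`). Low regret means that arm `m` is
rarely played on the hard instance, and almost always on the alternative one; by the
Bretagnolle-Huber inequality (`half_exp_integral_le_integral_min`) the sum of the two regrets after
`T` rounds is at least a multiple of `T * exp (-(δ ^ 2 / (2 σ ^ 2)) * x)`, where `x` is the
expected number of plays on arm `m` on the hard instance (`ofReal_le_regret_add_regret`).
Consistency makes this sum smaller than every positive power of `T`, whence `x` is asymptotically
at least `(2 σ ^ 2 / δ ^ 2) * log T`. Summation over the `M - 1` suboptimal arms gives the bound
`Δ (M - 1) (2 σ ^ 2 / δ ^ 2)` for the lower limit of the regret divided by `log T`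
(`ofReal_le_liminf_regret`).

If the algorithm is only consistent on the `Δ`-gap class, the alternative must have gap `Δ` as
well, which forces `δ = 2 Δ / w`; the bound is `w ^ 2 σ ^ 2 (M - 1) / (2 Δ)`, which suffices if
`w ≥ 4`. If it is consistent on all instances, then `δ` may tend to `Δ / w`, and the bound
`2 w ^ 2 σ ^ 2 (M - 1) / Δ` suffices if `w ≥ 1`.
-/

namespace MSBPRS

/-! ### Product measures and the Gaussian likelihood ratio -/

/-- A product of densities is a density of the product measure. -/
theorem lintegral_pi_of_density {ι Ω : Type*} [Fintype ι] [MeasurableSpace Ω]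
    (μ ν : ι → Measure Ω) [∀ i, IsProbabilityMeasure (μ i)] [∀ i, IsProbabilityMeasure (ν i)]
    (ρ : ι → Ω → ℝ≥0∞) (hρ : ∀ i, Measurable (ρ i)) (h : ∀ i, ν i = (μ i).withDensity (ρ i))
    {f : (ι → Ω) → ℝ≥0∞} (hf : Measurable f) :
    ∫⁻ x, f x ∂Measure.pi ν = ∫⁻ x, (∏ i, ρ i (x i)) * f x ∂Measure.pi μ := by
  have hprod : Measurable fun x : ι → Ω => ∏ i, ρ i (x i) := by fun_prop
  have key : Measure.pi ν = (Measure.pi μ).withDensity fun x => ∏ i, ρ i (x i) := by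
    refine (Measure.pi_eq fun s hs => ?_)
    have hind : iIndepFun (fun i (x : ι → Ω) => (s i).indicator (ρ i) (x i)) (Measure.pi μ) :=
      iIndepFun_pi (X := fun i => (s i).indicator (ρ i))
        fun i => ((hρ i).indicator (hs i)).aemeasurable
    have hmeas : ∀ i, Measurable fun x : ι → Ω => (s i).indicator (ρ i) (x i) :=
      fun i => ((hρ i).indicator (hs i)).comp (measurable_pi_apply i)
    rw [withDensity_apply _ (MeasurableSet.univ_pi hs),
      ← lintegral_indicator (MeasurableSet.univ_pi hs)]
    have hfac : ∀ x : ι → Ω, (Set.univ.pi s).indicator (fun x => ∏ i, ρ i (x i)) x =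
        ∏ i, (s i).indicator (ρ i) (x i) := by
      intro x
      by_cases hx : x ∈ Set.univ.pi s
      · rw [Set.indicator_of_mem hx]
        exact Finset.prod_congr rfl fun i _ => (Set.indicator_of_mem (hx i trivial) _).symm
      · rw [Set.indicator_of_notMem hx]
        simp only [Set.mem_pi, Set.mem_univ, forall_const, not_forall] at hx
        obtain ⟨i, hi⟩ := hx
        exact (Finset.prod_eq_zero (Finset.mem_univ i) (Set.indicator_of_notMem hi _)).symm
    simp_rw [hfac]
    rw [lintegral_prod_eq_prod_lintegral_of_indepFun _ _ hind hmeas]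
    refine Finset.prod_congr rfl fun i _ => ?_
    rw [h i, withDensity_apply _ (hs i), ← lintegral_indicator (hs i)]
    exact (measurePreserving_eval μ i).lintegral_comp ((hρ i).indicator (hs i))
  rw [key, lintegral_withDensity_eq_lintegral_mul _ hprod hf]
  rfl

/-- Under a product measure, distinct coordinates of a double array are independent: reading the
array along an injective list of positions gives a product measure. -/
theorem map_pi_pi_reindex {ι κ τ Ω : Type*} [Fintype ι] [Fintype κ] [Fintype τ]
    [MeasurableSpace Ω] (μ : ι → Measure Ω) [∀ i, IsProbabilityMeasure (μ i)]
    (p : τ → ι) (q : τ → κ) (hpq : Function.Injective fun t => (p t, q t)) :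
    (Measure.pi fun i => Measure.pi fun _ : κ => μ i).map (fun z t => z (p t) (q t)) =
      Measure.pi fun t => μ (p t) := by
  classical
  refine (Measure.pi_eq fun s hs => ?_).symm
  rw [Measure.map_apply (by fun_prop) (MeasurableSet.univ_pi hs)]
  let b : ι → κ → Set Ω := fun i j => {x | ∀ t, p t = i → q t = j → x ∈ s t}
  have hpre : (fun (z : ι → κ → Ω) t => z (p t) (q t)) ⁻¹' Set.univ.pi s =
      Set.univ.pi fun i => Set.univ.pi fun j => b i j := by
    ext z
    simp only [Set.mem_preimage, Set.mem_pi, Set.mem_univ, forall_const, b, Set.mem_ofPred_eq]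
    exact ⟨fun h i j t hi hj => hi ▸ hj ▸ h t, fun h t => h _ _ t rfl rfl⟩
  have hb : ∀ t, b (p t) (q t) = s t := by
    intro t
    ext x
    refine ⟨fun h => h t rfl rfl, fun h t' h1 h2 => ?_⟩
    obtain rfl : t' = t := hpq (Prod.ext h1 h2)
    exact h
  rw [hpre, Measure.pi_pi]
  simp_rw [Measure.pi_pi]
  rw [← Finset.prod_product' (f := fun i j => μ i (b i j))]
  have himg : ∏ t, μ (p t) (s t) =
      ∏ x ∈ Finset.univ.image (fun t => (p t, q t)), μ x.1 (b x.1 x.2) := by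
    rw [Finset.prod_image fun _ _ _ _ h => hpq h]
    simp_rw [hb]
  rw [himg]
  refine (Finset.prod_subset (fun x _ => by simp) fun x _ hx => ?_).symm
  have : b x.1 x.2 = Set.univ := by
    ext y
    simp only [b, Set.mem_ofPred_eq, Set.mem_univ, iff_true]
    intro t h1 h2
    exact absurd (Finset.mem_image.2 ⟨t, Finset.mem_univ t, Prod.ext h1 h2⟩) hx
  rw [this, measure_univ]

/-- The logarithm of the density of `gaussianReal (b + δ) (σ ^ 2)` with respect to
`gaussianReal b (σ ^ 2)`. -/
noncomputable def gaussianLLR (b δ : ℝ) (σ : ℝ≥0) (x : ℝ) : ℝ :=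
  (δ * (x - b) - δ ^ 2 / 2) / (σ : ℝ) ^ 2

theorem measurable_gaussianLLR (b δ : ℝ) (σ : ℝ≥0) : Measurable (gaussianLLR b δ σ) := by
  unfold gaussianLLR
  fun_prop

theorem gaussianReal_add_eq_withDensity (b δ : ℝ) {σ : ℝ≥0} (hσ : σ ≠ 0) :
    gaussianReal (b + δ) (σ ^ 2) = (gaussianReal b (σ ^ 2)).withDensity
      fun x => ENNReal.ofReal (Real.exp (gaussianLLR b δ σ x)) := by
  have hv : σ ^ 2 ≠ 0 := pow_ne_zero 2 hσ
  have hσ' : (σ : ℝ) ≠ 0 := by exact_mod_cast hσ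
  have hm : Measurable fun x => ENNReal.ofReal (Real.exp (gaussianLLR b δ σ x)) :=
    (measurable_gaussianLLR b δ σ).exp.ennreal_ofReal
  rw [gaussianReal_of_var_ne_zero _ hv, gaussianReal_of_var_ne_zero _ hv,
    ← withDensity_mul _ (measurable_gaussianPDF _ _) hm]
  congr 1
  ext x
  rw [Pi.mul_apply, gaussianPDF, gaussianPDF, ← ENNReal.ofReal_mul (gaussianPDFReal_nonneg _ _ _)]
  congr 1
  unfold gaussianPDFReal gaussianLLR
  rw [mul_assoc _ (Real.exp _) (Real.exp _), ← Real.exp_add]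
  congr 2
  push_cast
  field_simp
  ring

theorem integrable_gaussianLLR (b δ : ℝ) (σ : ℝ≥0) :
    Integrable (gaussianLLR b δ σ) (gaussianReal b (σ ^ 2)) := by
  have h : Integrable (fun x : ℝ => x) (gaussianReal b (σ ^ 2)) :=
    (memLp_id_gaussianReal 1).integrable le_rfl
  exact (((h.sub (integrable_const b)).const_mul δ).sub (integrable_const _)).div_const _

/-- The negative of the Kullback-Leibler divergence of two Gaussian laws of equal variance. -/
theorem integral_gaussianLLR (b δ : ℝ) (σ : ℝ≥0) :
    ∫ x, gaussianLLR b δ σ x ∂gaussianReal b (σ ^ 2) = -(δ ^ 2 / (2 * (σ : ℝ) ^ 2)) := by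
  have h : Integrable (fun x : ℝ => x) (gaussianReal b (σ ^ 2)) :=
    (memLp_id_gaussianReal 1).integrable le_rfl
  have h' : Integrable (fun x : ℝ => δ * (x - b)) (gaussianReal b (σ ^ 2)) :=
    (h.sub (integrable_const b)).const_mul δ
  unfold gaussianLLR
  rw [integral_div, integral_sub h' (integrable_const _), integral_const_mul,
    integral_sub h (integrable_const _), integral_id_gaussianReal]
  simp
  ring

theorem hasSubgaussianMGF_gaussianReal (b : ℝ) (v : ℝ≥0) :
    HasSubgaussianMGF (fun x => x - ∫ y, y ∂gaussianReal b v) v (gaussianReal b v) := by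
  have hmap : (gaussianReal b v).map (fun x => x - b) = gaussianReal 0 v := by
    rw [gaussianReal_map_sub_const, sub_self]
  rw [integral_id_gaussianReal]
  refine ⟨fun t => ?_, fun t => ?_⟩
  · have := integrable_exp_mul_gaussianReal (μ := 0) (v := v) t
    rw [← hmap] at this
    exact this.comp_measurable (by fun_prop)
  · rw [mgf_gaussianReal hmap]
    simp

/-! ### The Bretagnolle-Huber inequality -/

/-- If `exp L` is a likelihood ratio, then the overlap of the two laws, the integral of the smaller
of the two densities, is at least `exp (∫ L) / 2`; here `-∫ L` is their Kullback-Leibler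
divergence. -/
theorem half_exp_integral_le_integral_min {Ω : Type*} [MeasurableSpace Ω] (P : Measure Ω)
    [IsProbabilityMeasure P] {L : Ω → ℝ} (hL : Integrable L P)
    (hexp : Integrable (fun ω => Real.exp (L ω)) P) (hone : ∫ ω, Real.exp (L ω) ∂P = 1) :
    Real.exp (∫ ω, L ω ∂P) / 2 ≤ ∫ ω, min 1 (Real.exp (L ω)) ∂P := by
  set l := ∫ ω, L ω ∂P with hl
  set c := Real.exp (l / 2) with hc
  have hcc : c * c = Real.exp l := by rw [hc, ← Real.exp_add, add_halves]
  -- AM-GM bounds `√(min · max)` from above, and the tangent of `exp` at `l / 2` from below.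
  have hpt : ∀ x : ℝ, c * (c * (1 + (x - l) / 2)) - c * c / 4 * (1 + Real.exp x) ≤
      min 1 (Real.exp x) := by
    intro x
    have h1 : c * (1 + (x - l) / 2) ≤ Real.exp (x / 2) := by
      have := Real.add_one_le_exp ((x - l) / 2)
      calc c * (1 + (x - l) / 2) ≤ c * Real.exp ((x - l) / 2) := by
            gcongr
            linarith
        _ = Real.exp (x / 2) := by
            rw [hc, ← Real.exp_add]
            congr 1
            ring
    have hcpos : 0 < c := Real.exp_pos _
    have hx : Real.exp x = Real.exp (x / 2) ^ 2 := by rw [sq, ← Real.exp_add, add_halves]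
    have hxpos := Real.exp_pos (x / 2)
    have h2 := mul_le_mul_of_nonneg_left h1 hcpos.le
    rw [hx]
    generalize Real.exp (x / 2) = y at *
    refine le_min ?_ ?_
    · nlinarith [sq_nonneg (c * y / 2 - 1), sq_nonneg c]
    · nlinarith [sq_nonneg (c / 2 - y), sq_nonneg (c * y)]
  have hmin : Integrable (fun ω => min 1 (Real.exp (L ω))) P := (integrable_const 1).inf hexp
  have hI1 : Integrable (fun ω => 1 + (L ω - l) / 2) P :=
    (integrable_const _).add ((hL.sub (integrable_const _)).div_const _)
  have hI2 : Integrable (fun ω => c * (c * (1 + (L ω - l) / 2))) P := (hI1.const_mul c).const_mul c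
  have hI3 : Integrable (fun ω => 1 + Real.exp (L ω)) P := (integrable_const _).add hexp
  have hI4 : Integrable (fun ω => c * c / 4 * (1 + Real.exp (L ω))) P := hI3.const_mul _
  have hle := integral_mono (hI2.sub hI4) hmin fun ω => hpt (L ω)
  have e1 : ∫ ω, (1 + (L ω - l) / 2) ∂P = 1 := by
    have hLl : Integrable (fun ω => L ω - l) P := hL.sub (integrable_const l)
    rw [integral_add (integrable_const _) (hLl.div_const 2), integral_div,
      integral_sub hL (integrable_const _), ← hl]
    simp
  have e2 : ∫ ω, (1 + Real.exp (L ω)) ∂P = 2 := by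
    rw [integral_add (integrable_const _) hexp, hone]
    simp
    norm_num
  have e3 : ∫ ω, (c * (c * (1 + (L ω - l) / 2)) - c * c / 4 * (1 + Real.exp (L ω))) ∂P =
      c * c / 2 := by
    rw [integral_sub hI2 hI4, integral_const_mul, integral_const_mul, integral_const_mul, e1, e2]
    ring
  simp only [Pi.sub_apply] at hle
  rw [e3, hcc] at hle
  exact hle

/-! ### The law of the process and its change of measure -/

section Trajectory

variable {M K : ℕ} {σ : ℝ≥0} (I J : Instance M K σ) (π : Policy M K)

instance isProbabilityMeasure_processLaw : IsProbabilityMeasure (processLaw I π) := by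
  have := π.next_markov
  have := π.first_prob
  unfold processLaw
  infer_instance

open Preorder in
theorem lintegral_processLaw_succ (n : ℕ) {f : (Finset.Iic n → Round M K) × Round M K → ℝ≥0∞}
    (hf : Measurable f) :
    ∫⁻ ω, f (frestrictLe n ω, ω (n + 1)) ∂processLaw I π =
      ∫⁻ ω, ∫⁻ a, ∫⁻ y, f (frestrictLe n ω, (a, y)) ∂I.feedbackKernel a
        ∂π.next n (frestrictLe n ω) ∂processLaw I π := by
  have := π.next_markov
  have := π.first_prob
  have h := Kernel.map_frestrictLe_trajMeasure_compProd_eq_map_trajMeasure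
    (X := fun _ => Round M K) (μ₀ := π.first ⊗ₘ I.feedbackKernel)
    (κ := fun n => π.next n ⊗ₖ I.feedbackKernel.prodMkLeft _) (a := n)
  change (processLaw I π).map (frestrictLe n) ⊗ₘ _ = (processLaw I π).map _ at h
  have h1 := congrArg (fun m => ∫⁻ x, f x ∂m) h
  rw [lintegral_map hf (by fun_prop), Measure.lintegral_compProd hf,
    lintegral_map (by fun_prop) (by fun_prop)] at h1
  rw [← h1]
  refine lintegral_congr fun ω => ?_
  rw [Kernel.lintegral_compProd _ _ _ (by fun_prop)]
  rfl

open Preorder in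
theorem lintegral_processLaw_zero {f : Round M K → ℝ≥0∞} (hf : Measurable f) :
    ∫⁻ ω, f (ω 0) ∂processLaw I π =
      ∫⁻ a, ∫⁻ y, f (a, y) ∂I.feedbackKernel a ∂π.first := by
  have := π.next_markov
  have := π.first_prob
  have h : (processLaw I π).map (fun ω => ω 0) = π.first ⊗ₘ I.feedbackKernel := by
    have hx : (processLaw I π).map (frestrictLe 0) =
        (π.first ⊗ₘ I.feedbackKernel).map
          (MeasurableEquiv.piUnique fun _ : Finset.Iic 0 => Round M K).symm := by
      unfold processLaw
      rw [Kernel.trajMeasure, Measure.map_comp _ _ (by fun_prop), Kernel.traj_map_frestrictLe,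
        Kernel.partialTraj_self]
      exact Measure.id_comp
    have h0 : (fun ω : ℕ → Round M K => ω 0) =
        (MeasurableEquiv.piUnique fun _ : Finset.Iic 0 => Round M K) ∘ frestrictLe 0 := rfl
    rw [h0, ← Measure.map_map (by fun_prop) (by fun_prop), hx,
      Measure.map_map (by fun_prop) (by fun_prop)]
    rw [MeasurableEquiv.self_comp_symm, Measure.map_id]
  rw [← lintegral_map hf (measurable_pi_apply 0), h, Measure.lintegral_compProd hf]

/-- Given the action profile of a round, the feedback of the round does not depend on the past. -/
theorem lintegral_processLaw_round (t : ℕ) {f : Round M K → ℝ≥0∞} (hf : Measurable f) :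
    ∫⁻ ω, f (ω t) ∂processLaw I π =
      ∫⁻ ω, ∫⁻ y, f ((ω t).1, y) ∂I.feedbackKernel (ω t).1 ∂processLaw I π := by
  have hG : Measurable fun a => ∫⁻ y, f (a, y) ∂I.feedbackKernel a := measurable_of_countable _
  cases t with
  | zero =>
    rw [lintegral_processLaw_zero I π hf,
      lintegral_processLaw_zero I π
        (f := fun r => ∫⁻ y, f (r.1, y) ∂I.feedbackKernel r.1) (hG.comp measurable_fst)]
    simp
  | succ n =>
    rw [lintegral_processLaw_succ I π n (f := fun p => f p.2) (hf.comp measurable_snd),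
      lintegral_processLaw_succ I π n
        (f := fun p => ∫⁻ y, f (p.2.1, y) ∂I.feedbackKernel p.2.1)
        (hG.comp (measurable_fst.comp measurable_snd))]
    simp

theorem map_processLaw_round (t : ℕ) :
    (processLaw I π).map (fun ω => ω t) =
      (processLaw I π).map (fun ω => (ω t).1) ⊗ₘ I.feedbackKernel := by
  refine Measure.ext_of_lintegral _ fun f hf => ?_
  rw [lintegral_map hf (measurable_pi_apply t), lintegral_processLaw_round I π t hf,
    Measure.lintegral_compProd hf, lintegral_map (measurable_of_countable _) (by fun_prop)]

theorem integrable_processLaw_round (t : ℕ) {f : Round M K → ℝ} (hf : Measurable f)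
    (hi : ∀ a, Integrable (fun y => f (a, y)) (I.feedbackKernel a)) :
    Integrable (fun ω => f (ω t)) (processLaw I π) := by
  have : IsProbabilityMeasure ((processLaw I π).map fun ω => (ω t).1) :=
    Measure.isProbabilityMeasure_map (measurable_fst.comp (measurable_pi_apply t)).aemeasurable
  have h : Integrable f ((processLaw I π).map fun ω => ω t) := by
    rw [map_processLaw_round, Measure.integrable_compProd_iff hf.aestronglyMeasurable]
    exact ⟨ae_of_all _ hi, .of_finite⟩
  exact h.comp_measurable (measurable_pi_apply t)

theorem integral_processLaw_round (t : ℕ) {f : Round M K → ℝ} (hf : Measurable f)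
    (hi : ∀ a, Integrable (fun y => f (a, y)) (I.feedbackKernel a)) :
    ∫ ω, f (ω t) ∂processLaw I π =
      ∫ ω, ∫ y, f ((ω t).1, y) ∂I.feedbackKernel (ω t).1 ∂processLaw I π := by
  have : IsProbabilityMeasure ((processLaw I π).map fun ω => (ω t).1) :=
    Measure.isProbabilityMeasure_map (measurable_fst.comp (measurable_pi_apply t)).aemeasurable
  have h : Integrable f ((processLaw I π).map fun ω => ω t) := by
    rw [map_processLaw_round, Measure.integrable_compProd_iff hf.aestronglyMeasurable]
    exact ⟨ae_of_all _ hi, .of_finite⟩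
  rw [← integral_map (measurable_pi_apply t).aemeasurable hf.aestronglyMeasurable,
    map_processLaw_round, Measure.integral_compProd (map_processLaw_round I π t ▸ h),
    integral_map (φ := fun ω : ℕ → Round M K => (ω t).1)
      (measurable_fst.comp (measurable_pi_apply t)).aemeasurable
      (measurable_of_countable _).aestronglyMeasurable]

/-- Extends a history by one round. -/
def extendHistory (n : ℕ) (p : (Finset.Iic n → Round M K) × Round M K) :
    Finset.Iic (n + 1) → Round M K :=
  fun i => if h : i.1 ≤ n then p.1 ⟨i.1, Finset.mem_Iic.2 h⟩ else p.2

theorem measurable_extendHistory (n : ℕ) :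
    Measurable (extendHistory n : (Finset.Iic n → Round M K) × Round M K → _) := by
  refine measurable_pi_lambda _ fun i => ?_
  unfold extendHistory
  split_ifs <;> fun_prop

open Preorder in
theorem extendHistory_frestrictLe (n : ℕ) (ω : ℕ → Round M K) :
    extendHistory n (frestrictLe n ω, ω (n + 1)) = frestrictLe (n + 1) ω := by
  funext i
  have hi := Finset.mem_Iic.1 i.2
  by_cases h : i.1 ≤ n
  · simp [extendHistory, h]
  · have : i.1 = n + 1 := by omega
    simp [extendHistory, this]

open Preorder in
/-- If `ρ` is a density of the feedback laws of `J` with respect to those of `I`, then the product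
of its values along the rounds is a likelihood ratio of the histories: the policy, being the same
on both instances, does not contribute. -/
theorem lintegral_processLaw_of_density {ρ : Round M K → ℝ≥0∞} (hρ : Measurable ρ)
    (h : ∀ a, ∀ f : Feedback M K → ℝ≥0∞, Measurable f →
      ∫⁻ y, f y ∂J.feedbackKernel a = ∫⁻ y, ρ (a, y) * f y ∂I.feedbackKernel a)
    (n : ℕ) {f : (Finset.Iic n → Round M K) → ℝ≥0∞} (hf : Measurable f) :
    ∫⁻ ω, f (frestrictLe n ω) ∂processLaw J π =
      ∫⁻ ω, (∏ t ∈ Finset.Iic n, ρ (ω t)) * f (frestrictLe n ω) ∂processLaw I π := by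
  induction n with
  | zero =>
    have h0 : ∀ ω : ℕ → Round M K, frestrictLe 0 ω = fun _ => ω 0 := by
      intro ω
      funext i
      have : i.1 = 0 := Nat.le_zero.1 (Finset.mem_Iic.1 i.2)
      simp [this]
    have hI : Finset.Iic 0 = {0} := rfl
    have hf' : Measurable fun x : Round M K => f fun _ => x := hf.comp (by fun_prop)
    simp only [h0, hI, Finset.prod_singleton]
    rw [lintegral_processLaw_zero J π hf',
      lintegral_processLaw_zero I π (f := fun x => ρ x * f fun _ => x) (hρ.mul hf')]
    refine lintegral_congr fun a => h a _ ?_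
    exact hf'.comp measurable_prodMk_left
  | succ n ih =>
    have := π.next_markov
    have hg : Measurable fun p => f (extendHistory n p) := hf.comp (measurable_extendHistory n)
    let F : (Finset.Iic n → Round M K) → ℝ≥0∞ := fun x =>
      ∫⁻ a, ∫⁻ y, ρ (a, y) * f (extendHistory n (x, (a, y))) ∂I.feedbackKernel a ∂π.next n x
    let G : (Finset.Iic n → Round M K) → ℝ≥0∞ := fun x =>
      ∫⁻ z, ρ z * f (extendHistory n (x, z))
        ∂(π.next n ⊗ₖ I.feedbackKernel.prodMkLeft _ : Kernel _ (Round M K)) x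
    have hG : Measurable G :=
      Measurable.lintegral_kernel_prod_right' (f := fun p => ρ p.2 * f (extendHistory n p))
        ((hρ.comp measurable_snd).mul hg)
    have hFG : F = G := by
      funext x
      have hm : Measurable fun z => ρ z * f (extendHistory n (x, z)) :=
        hρ.mul (hg.comp measurable_prodMk_left)
      exact (Kernel.lintegral_compProd (π.next n) (I.feedbackKernel.prodMkLeft _) x hm).symm
    have hF : Measurable F := hFG ▸ hG
    have hprod : Measurable fun x : Finset.Iic n → Round M K => ∏ i, ρ (x i) := by fun_prop
    have hpr : ∀ ω : ℕ → Round M K,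
        ∏ i, ρ (frestrictLe n ω i) = ∏ t ∈ Finset.Iic n, ρ (ω t) := fun ω =>
      Finset.prod_coe_sort (Finset.Iic n) fun t => ρ (ω t)
    have hJ : ∫⁻ ω, f (frestrictLe (n + 1) ω) ∂processLaw J π =
        ∫⁻ ω, F (frestrictLe n ω) ∂processLaw J π := by
      simp_rw [← extendHistory_frestrictLe n]
      rw [lintegral_processLaw_succ J π n hg]
      refine lintegral_congr fun ω => lintegral_congr fun a => h a _ ?_
      exact hg.comp (measurable_prodMk_left.comp measurable_prodMk_left)
    have hI : ∫⁻ ω, (∏ t ∈ Finset.Iic (n + 1), ρ (ω t)) * f (frestrictLe (n + 1) ω)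
        ∂processLaw I π = ∫⁻ ω, (∏ t ∈ Finset.Iic n, ρ (ω t)) * F (frestrictLe n ω)
          ∂processLaw I π := by
      have hs : ∀ ω : ℕ → Round M K,
          (∏ t ∈ Finset.Iic (n + 1), ρ (ω t)) * f (frestrictLe (n + 1) ω) =
            (fun p : (Finset.Iic n → Round M K) × Round M K =>
              (∏ i, ρ (p.1 i)) * (ρ p.2 * f (extendHistory n p)))
              (frestrictLe n ω, ω (n + 1)) := by
        intro ω
        simp only [hpr, extendHistory_frestrictLe]
        rw [← Nat.range_succ_eq_Iic, Finset.prod_range_succ, Nat.range_succ_eq_Iic, mul_assoc]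
      simp_rw [hs]
      rw [lintegral_processLaw_succ I π n
        (f := fun p => (∏ i, ρ (p.1 i)) * (ρ p.2 * f (extendHistory n p)))
        ((hprod.comp measurable_fst).mul ((hρ.comp measurable_snd).mul hg))]
      refine lintegral_congr fun ω => ?_
      simp only [hpr]
      have hm : ∀ a, Measurable fun y =>
          ρ (a, y) * f (extendHistory n (frestrictLe n ω, (a, y))) := fun a =>
        (hρ.comp measurable_prodMk_left).mul
          (hg.comp (measurable_prodMk_left.comp measurable_prodMk_left))
      simp_rw [fun a => lintegral_const_mul (∏ t ∈ Finset.Iic n, ρ (ω t)) (hm a)]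
      rw [lintegral_const_mul _ (measurable_of_countable _)]
    rw [hJ, hI, ih hF]

end Trajectory

/-! ### Gaussian instances without scarcity and without movement costs -/

section Gaussian

variable {M K : ℕ}

/-- Public data in which all plays have the weight `w`, all movements are free, and an arm may have
a capacity sufficient for all plays. -/
noncomputable def uniformPublicData (M K : ℕ) [NeZero M] (w : ℝ) (hw : 0 < w) :
    PublicData M K where
  weight _ := w
  weight_pos _ := hw
  weight_anti _ _ _ := le_rfl
  cost _ _ := 0
  exists_available _ := ⟨0, ENNReal.zero_ne_top⟩
  dMax := K

/-- The instance in which the plays do not compete: each arm has capacity `K`, and the per-unit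
reward of arm `m` is Gaussian with mean `ν m` and variance `σ ^ 2`. -/
noncomputable def gaussianInstance [NeZero M] [NeZero K] (σ : ℝ≥0) (w : ℝ) (hw : 0 < w)
    (ν : Fin M → ℝ) (hν : ∀ m, 0 < ν m) : Instance M K σ where
  toPublicData := uniformPublicData M K w hw
  capacity _ := PMF.pure K
  capacity_support m := by
    simp [uniformPublicData, Nat.one_le_iff_ne_zero, NeZero.ne K]
  reward m := gaussianReal (ν m) (σ ^ 2)
  reward_prob m := inferInstance
  reward_mean_pos m := by
    rw [integral_id_gaussianReal]
    exact hν m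
  reward_subgaussian m := hasSubgaussianMGF_gaussianReal _ _

theorem rank_le (a : Action M K) (k : Fin K) : rank a k ≤ K := by
  simpa [rank] using Finset.card_le_univ (Finset.univ.filter fun j => j ≤ k ∧ a j = a k)

theorem rank_pos (a : Action M K) (k : Fin K) : 0 < rank a k :=
  Finset.card_pos.2 ⟨k, by simp⟩

theorem rank_lt_rank (a : Action M K) {j k : Fin K} (hjk : j < k) (h : a j = a k) :
    rank a j < rank a k := by
  refine Finset.card_lt_card ((Finset.ssubset_iff_of_subset fun i hi => ?_).2 ⟨k, ?_, ?_⟩)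
  · simp only [Finset.mem_filter, Finset.mem_univ, true_and] at hi ⊢
    exact ⟨hi.1.trans hjk.le, hi.2.trans h⟩
  · simp
  · simp [hjk]

/-- Different plays use different units of capacity. -/
theorem injective_arm_rank (a : Action M K) :
    Function.Injective fun k => (a k, (⟨rank a k - 1, rank_pred_lt a k⟩ : Fin K)) := by
  intro j k h
  simp only [Prod.mk.injEq, Fin.mk.injEq] at h
  have hj := rank_pos a j
  have hk := rank_pos a k
  rcases lt_trichotomy j k with hlt | heq | hlt
  · have := rank_lt_rank a hlt h.1
    omega
  · exact heq
  · have := rank_lt_rank a hlt h.1.symm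
    omega

/-- The feedback of a round in which no play is turned away, as a function of the per-unit rewards
of the plays. -/
noncomputable def fullFeedback (w : ℝ) (a : Action M K) (x : Fin K → ℝ) : Feedback M K :=
  (fun k => Sum.inl (w * x k), capacityFeedback a (fun _ => K, fun _ _ => 0))

theorem measurable_fullFeedback (w : ℝ) (a : Action M K) : Measurable (fullFeedback w a) := by
  refine Measurable.prodMk (measurable_pi_lambda _ fun k => ?_) measurable_const
  exact measurable_inl.comp (by fun_prop)

/-- The number of plays that the action profile `a` assigns to arm `m`. -/
def playCount (a : Action M K) (m : Fin M) : ℝ := ∑ k, if a k = m then 1 else 0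

theorem playCount_nonneg (a : Action M K) (m : Fin M) : 0 ≤ playCount a m :=
  Finset.sum_nonneg fun _ _ => by split_ifs <;> norm_num

theorem sum_playCount (a : Action M K) : ∑ m, playCount a m = K := by
  unfold playCount
  rw [Finset.sum_comm]
  simp

theorem playCount_le (a : Action M K) (m : Fin M) : playCount a m ≤ K := by
  rw [← sum_playCount a]
  exact Finset.single_le_sum (fun i _ => playCount_nonneg a i) (Finset.mem_univ m)

variable [NeZero M] [NeZero K] (σ : ℝ≥0) (w : ℝ) (hw : 0 < w) (ν : Fin M → ℝ) (hν : ∀ m, 0 < ν m)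

theorem feedbackKernel_gaussianInstance (a : Action M K) :
    (gaussianInstance σ w hw ν hν).feedbackKernel a =
      (Measure.pi fun k => gaussianReal (ν (a k)) (σ ^ 2)).map (fullFeedback w a) := by
  have hd : (Measure.pi fun _ : Fin M => (PMF.pure K).toMeasure) =
      Measure.dirac fun _ : Fin M => K := by
    simp_rw [PMF.toMeasure_pure]
    refine Measure.pi_eq fun s hs => ?_
    rw [Measure.dirac_apply, Finset.prod_congr rfl fun i _ => Measure.dirac_apply K (s i)]
    by_cases h : ∀ i, K ∈ s i
    · simp [h]
    · rw [Set.indicator_of_notMem (by simpa using h)]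
      push Not at h
      obtain ⟨i, hi⟩ := h
      exact (Finset.prod_eq_zero (Finset.mem_univ i) (Set.indicator_of_notMem hi _)).symm
  have hpos := map_pi_pi_reindex (κ := Fin K) (fun m => gaussianReal (ν m) (σ ^ 2)) a _
    (injective_arm_rank a)
  change Measure.map (feedback (uniformPublicData M K w hw) a)
    ((Measure.pi fun _ : Fin M => (PMF.pure K).toMeasure).prod
      (Measure.pi fun m => Measure.pi fun _ : Fin K => gaussianReal (ν m) (σ ^ 2))) = _
  rw [hd, Measure.dirac_prod, Measure.map_map (measurable_feedback _ a) measurable_prodMk_left,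
    ← hpos, Measure.map_map (measurable_fullFeedback w a) (by fun_prop)]
  congr 1
  funext z
  refine Prod.ext (funext fun k => ?_) rfl
  simp [feedback, playReward, rank_le, fullFeedback, uniformPublicData]

theorem utility_gaussianInstance (a : Action M K) :
    (gaussianInstance σ w hw ν hν).utility a = ((w * ∑ m, ν m * playCount a m : ℝ) : EReal) := by
  have htail : ∀ (m : Fin M) (k : Fin K),
      (gaussianInstance (K := K) σ w hw ν hν).tail m (rank a k) = 1 := by
    intro m k
    change (PMF.pure K).toMeasure.real _ = 1
    rw [PMF.toMeasure_pure]
    simp [rank_le, Measure.real]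
  have harm : ∀ m, (gaussianInstance σ w hw ν hν).armUtility a m =
      ((w * (ν m * playCount a m) : ℝ) : EReal) := by
    intro m
    have hmean : (gaussianInstance (K := K) σ w hw ν hν).mean m = ν m := integral_id_gaussianReal
    have hcost : ∑ k, (if a k = m then (gaussianInstance σ w hw ν hν).cost k m else 0) = 0 := by
      simp [gaussianInstance, uniformPublicData]
    rw [Instance.armUtility, hcost, Instance.armReward, hmean]
    simp only [htail]
    have : ∑ k, (if a k = m then (gaussianInstance σ w hw ν hν).weight k * 1 else 0) =
        w * playCount a m := by
      rw [playCount, Finset.mul_sum]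
      refine Finset.sum_congr rfl fun k _ => ?_
      simp [gaussianInstance, uniformPublicData]
    rw [this]
    simp
    norm_cast
    ring
  rw [Instance.utility, Finset.mul_sum]
  simp_rw [harm]
  exact (map_sum (⟨⟨Real.toEReal, EReal.coe_zero⟩, EReal.coe_add⟩ : ℝ →+ EReal) _ _).symm

end Gaussian

/-! ### The likelihood ratio of two instances that differ on one arm -/

section Likelihood

variable {M K : ℕ}

/-- The log-likelihood ratio of a round, when the mean of arm `m` is raised from `b` to `b + δ`;
the rewards of the plays on arm `m` are divided by the weight `w`. -/
noncomputable def roundLLR (m : Fin M) (w b δ : ℝ) (σ : ℝ≥0) (r : Round M K) : ℝ :=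
  ∑ k, if r.1 k = m then gaussianLLR b δ σ (Sum.elim id (fun _ => 0) (r.2.1 k) / w) else 0

theorem measurable_roundLLR (m : Fin M) (w b δ : ℝ) (σ : ℝ≥0) :
    Measurable (roundLLR m w b δ σ : Round M K → ℝ) := by
  refine Finset.measurable_sum _ fun k _ => Measurable.ite ?_ ?_ measurable_const
  · exact measurableSet_eq_fun ((measurable_pi_apply k).comp measurable_fst) measurable_const
  · refine (measurable_gaussianLLR b δ σ).comp (Measurable.div_const ?_ w)
    exact (measurable_id.sumElim measurable_const).comp
      ((measurable_pi_apply k).comp (measurable_fst.comp measurable_snd))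

theorem roundLLR_fullFeedback (m : Fin M) {w : ℝ} (hw : 0 < w) (b δ : ℝ) (σ : ℝ≥0)
    (a : Action M K) (x : Fin K → ℝ) :
    roundLLR m w b δ σ (a, fullFeedback w a x) =
      ∑ k, if a k = m then gaussianLLR b δ σ (x k) else 0 := by
  simp [roundLLR, fullFeedback, mul_div_cancel_left₀ _ hw.ne']

/-- The expected log-likelihood ratio gained by a single play. -/
theorem integral_gaussianLLR_play (σ : ℝ≥0) (ν : Fin M → ℝ)
    (m : Fin M) (δ : ℝ) (a : Action M K) (k : Fin K) :
    Integrable (fun x : Fin K → ℝ => if a k = m then gaussianLLR (ν m) δ σ (x k) else 0)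
        (Measure.pi fun k => gaussianReal (ν (a k)) (σ ^ 2)) ∧
      ∫ x, (if a k = m then gaussianLLR (ν m) δ σ (x k) else 0)
        ∂(Measure.pi fun k => gaussianReal (ν (a k)) (σ ^ 2)) =
      -(δ ^ 2 / (2 * (σ : ℝ) ^ 2)) * if a k = m then 1 else 0 := by
  by_cases h : a k = m
  · subst h
    have hmp := measurePreserving_eval (fun k => gaussianReal (ν (a k)) (σ ^ 2)) k
    simp only [if_true, mul_one]
    refine ⟨hmp.integrable_comp_of_integrable (integrable_gaussianLLR (ν (a k)) δ σ), ?_⟩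
    rw [← integral_gaussianLLR (ν (a k)) δ σ, ← hmp.map_eq, integral_map hmp.aemeasurable
      (measurable_gaussianLLR _ _ _).aestronglyMeasurable]
  · simp [h]

variable [NeZero M] [NeZero K] (σ : ℝ≥0) (w : ℝ) (hw : 0 < w) (ν : Fin M → ℝ) (hν : ∀ m, 0 < ν m)

theorem lintegral_feedbackKernel_shift (hσ : σ ≠ 0) (m : Fin M) (δ : ℝ)
    (hν' : ∀ i, 0 < Function.update ν m (ν m + δ) i) (a : Action M K)
    {f : Feedback M K → ℝ≥0∞} (hf : Measurable f) :
    ∫⁻ y, f y ∂(gaussianInstance σ w hw _ hν').feedbackKernel a =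
      ∫⁻ y, ENNReal.ofReal (Real.exp (roundLLR m w (ν m) δ σ (a, y))) * f y
        ∂(gaussianInstance σ w hw ν hν).feedbackKernel a := by
  have hm := measurable_fullFeedback w a
  have hL : Measurable fun y : Feedback M K =>
      ENNReal.ofReal (Real.exp (roundLLR m w (ν m) δ σ (a, y))) :=
    ((measurable_roundLLR m w (ν m) δ σ).comp measurable_prodMk_left).exp.ennreal_ofReal
  rw [feedbackKernel_gaussianInstance, feedbackKernel_gaussianInstance, lintegral_map hf hm,
    lintegral_map (f := fun y => _ * f y) (hL.mul hf) hm]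
  rw [lintegral_pi_of_density (f := fun x => f (fullFeedback w a x))
    (fun k => gaussianReal (ν (a k)) (σ ^ 2)) _
    (fun k x => ENNReal.ofReal (Real.exp (if a k = m then gaussianLLR (ν m) δ σ x else 0)))
    ?_ ?_ (hf.comp hm)]
  · refine lintegral_congr fun x => ?_
    rw [roundLLR_fullFeedback m hw, Real.exp_sum,
      ENNReal.ofReal_prod_of_nonneg fun _ _ => (Real.exp_pos _).le]
  · intro k
    split_ifs
    · exact (measurable_gaussianLLR _ _ _).exp.ennreal_ofReal
    · exact measurable_const
  · intro k
    by_cases h : a k = m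
    · simp only [h, if_true, Function.update_self]
      exact gaussianReal_add_eq_withDensity _ _ hσ
    · simp [h]

theorem integrable_roundLLR (m : Fin M) (δ : ℝ) (a : Action M K) :
    Integrable (fun y => roundLLR m w (ν m) δ σ (a, y))
      ((gaussianInstance σ w hw ν hν).feedbackKernel a) := by
  have hL : Measurable fun y : Feedback M K => roundLLR m w (ν m) δ σ (a, y) :=
    (measurable_roundLLR m w (ν m) δ σ).comp measurable_prodMk_left
  rw [feedbackKernel_gaussianInstance, integrable_map_measure hL.aestronglyMeasurable
    (measurable_fullFeedback w a).aemeasurable]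
  have : (fun y => roundLLR m w (ν m) δ σ (a, y)) ∘ fullFeedback w a =
      fun x => ∑ k, if a k = m then gaussianLLR (ν m) δ σ (x k) else 0 :=
    funext fun x => roundLLR_fullFeedback m hw _ _ _ _ _
  rw [this]
  exact integrable_finsetSum _ fun k _ => (integral_gaussianLLR_play σ ν m δ a k).1

/-- The information about arm `m` gained in a round is proportional to the number of plays on
arm `m`, as is the regret caused by these plays. -/
theorem integral_roundLLR (m : Fin M) (δ : ℝ) (a : Action M K) :
    ∫ y, roundLLR m w (ν m) δ σ (a, y) ∂(gaussianInstance σ w hw ν hν).feedbackKernel a =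
      -(δ ^ 2 / (2 * (σ : ℝ) ^ 2)) * playCount a m := by
  have hL : Measurable fun y : Feedback M K => roundLLR m w (ν m) δ σ (a, y) :=
    (measurable_roundLLR m w (ν m) δ σ).comp measurable_prodMk_left
  rw [feedbackKernel_gaussianInstance, integral_map (measurable_fullFeedback w a).aemeasurable
    hL.aestronglyMeasurable]
  simp_rw [roundLLR_fullFeedback m hw]
  rw [integral_finsetSum _ fun k _ => (integral_gaussianLLR_play σ ν m δ a k).1, playCount,
    Finset.mul_sum]
  exact Finset.sum_congr rfl fun k _ => (integral_gaussianLLR_play σ ν m δ a k).2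

end Likelihood

/-! ### Utility gap and regret of instances with real utilities -/

section Utility

variable {M K : ℕ} {σ : ℝ≥0}

theorem Instance.optUtility_eq (I : Instance M K σ) {u : Action M K → ℝ}
    (hu : ∀ a, I.utility a = u a) {U : ℝ} {a₀ : Action M K} (h₀ : u a₀ = U)
    (hle : ∀ a, u a ≤ U) : I.optUtility = U := by
  refine le_antisymm (iSup_le fun a => ?_) ?_
  · rw [hu]
    exact_mod_cast hle a
  · rw [← h₀, ← hu]
    exact le_iSup I.utility a₀

theorem Instance.utilityGap_eq (I : Instance M K σ) {u : Action M K → ℝ}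
    (hu : ∀ a, I.utility a = u a) {U Δ : ℝ} (hΔ : 0 < Δ) {a₀ a₁ : Action M K} (h₀ : u a₀ = U)
    (h₁ : u a₁ = U - Δ) (hle : ∀ a, u a = U ∨ u a ≤ U - Δ) : I.utilityGap = Δ := by
  have hopt := I.optUtility_eq hu h₀ fun a => (hle a).elim le_of_eq fun h => by linarith
  have hsec : ⨆ a, ⨆ (_ : I.utility a ≠ I.optUtility), I.utility a = ((U - Δ : ℝ) : EReal) := by
    refine le_antisymm (iSup₂_le fun a ha => ?_) ?_
    · rw [hu, hopt] at ha
      rw [hu]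
      exact_mod_cast (hle a).resolve_left fun h => ha (by rw [h])
    · have hne : I.utility a₁ ≠ I.optUtility := by
        rw [hu, hopt, h₁]
        exact_mod_cast (by linarith : U - Δ < U).ne
      refine le_of_eq_of_le ?_ (le_iSup₂ (f := fun a _ => I.utility a) a₁ hne)
      rw [hu, h₁]
  rw [Instance.utilityGap, hsec, hopt]
  norm_cast
  ring

theorem integrable_of_action (I : Instance M K σ) (π : Policy M K) (f : Action M K → ℝ) (t : ℕ) :
    Integrable (fun ω => f (ω t).1) (processLaw I π) :=
  integrable_processLaw_round I π t (f := fun r => f r.1)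
    ((measurable_of_countable f).comp measurable_fst) fun a => integrable_const (f a)

theorem regret_eq (A : Algorithm M K) (I : Instance M K σ) {u : Action M K → ℝ}
    (hu : ∀ a, I.utility a = u a) {U : ℝ} (hU : I.optUtility = U) (hle : ∀ a, u a ≤ U) (T : ℕ) :
    regret A I T = ∫⁻ ω, ENNReal.ofReal (∑ t ∈ Finset.range T, (U - u (ω t).1))
      ∂processLaw I (A I.toPublicData) := by
  refine lintegral_congr fun ω => ?_
  rw [ENNReal.ofReal_sum_of_nonneg fun t _ => sub_nonneg.2 (hle _)]
  refine Finset.sum_congr rfl fun t _ => ?_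
  rw [hu, hU, ← EReal.coe_sub, EReal.toENNReal_of_ne_top (EReal.coe_ne_top _), EReal.toReal_coe]

end Utility

section Counts

variable {M K : ℕ}

theorem playCount_add_le (a : Action M K) {i j : Fin M} (hij : i ≠ j) :
    playCount a i + playCount a j ≤ K := by
  rw [← sum_playCount a, ← Finset.sum_pair hij]
  exact Finset.sum_le_sum_of_subset_of_nonneg (Finset.subset_univ _)
    fun m _ _ => playCount_nonneg a m

/-- The play counts are integers. -/
theorem playCount_eq_or_le (a : Action M K) (m : Fin M) :
    playCount a m = K ∨ playCount a m ≤ K - 1 := by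
  have h : playCount a m = ((Finset.univ.filter fun k => a k = m).card : ℝ) := by
    simp [playCount]
  have hle : (Finset.univ.filter fun k => a k = m).card ≤ K := by
    simpa using Finset.card_le_univ (Finset.univ.filter fun k => a k = m)
  rw [h]
  rcases hle.eq_or_lt with h1 | h1
  · exact .inl (by rw [h1])
  · refine .inr ?_
    have : ((Finset.univ.filter fun k => a k = m).card : ℝ) + 1 ≤ K := by exact_mod_cast h1
    linarith

theorem playCount_const (i m : Fin M) :
    playCount (fun _ : Fin K => i) m = if i = m then (K : ℝ) else 0 := by
  simp [playCount]

theorem playCount_update (a : Action M K) (k : Fin K) (j m : Fin M) :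
    playCount (Function.update a k j) m =
      playCount a m - (if a k = m then 1 else 0) + if j = m then 1 else 0 := by
  unfold playCount
  rw [← Finset.add_sum_erase _ _ (Finset.mem_univ k),
    ← Finset.add_sum_erase (a := k) _ (fun k => if a k = m then (1 : ℝ) else 0) (Finset.mem_univ k)]
  have : ∑ x ∈ Finset.univ.erase k, (if Function.update a k j x = m then (1 : ℝ) else 0) =
      ∑ x ∈ Finset.univ.erase k, if a x = m then 1 else 0 :=
    Finset.sum_congr rfl fun x hx => by rw [Function.update_of_ne (Finset.ne_of_mem_erase hx)]
  rw [this, Function.update_self]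
  ring

theorem raised_utility_le [NeZero M] {w Δ : ℝ} (hΔ : 0 < Δ) {m : Fin M} (hm : m ≠ 0) {δ : ℝ}
    (a : Action M K) : w * K + Δ * playCount a 0 + w * δ * playCount a m ≤
      w * K + w * δ * K - (w * δ - Δ) * (K - playCount a m) := by
  nlinarith [playCount_add_le a hm]

end Counts

/-! ### The hard instance and its alternatives -/

section Hard

variable {M K : ℕ} [NeZero M] [NeZero K]

/-- The means of the hard instance: moving a play of weight `w` from arm `0` to another arm
costs `Δ`. -/
noncomputable def hardMean (M : ℕ) [NeZero M] (w Δ : ℝ) (m : Fin M) : ℝ :=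
  if m = 0 then 1 + Δ / w else 1

variable (σ : ℝ≥0) {w Δ : ℝ}

theorem hardMean_pos (hw : 0 < w) (hΔ : 0 < Δ) (m : Fin M) : 0 < hardMean M w Δ m := by
  unfold hardMean
  split_ifs <;> positivity

theorem update_hardMean_pos (hw : 0 < w) (hΔ : 0 < Δ) (m : Fin M) {δ : ℝ} (hδ : 0 < δ)
    (i : Fin M) : 0 < Function.update (hardMean M w Δ) m (hardMean M w Δ m + δ) i := by
  have := hardMean_pos (M := M) hw hΔ
  by_cases h : i = m
  · subst h
    rw [Function.update_self]
    linarith [this i]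
  · rw [Function.update_of_ne h]
    exact this i

/-- The instance with the means `hardMean`, of which arm `0` is the best arm. -/
noncomputable def hardInstance (M K : ℕ) [NeZero M] [NeZero K] (σ : ℝ≥0) (hw : 0 < w)
    (hΔ : 0 < Δ) : Instance M K σ :=
  gaussianInstance σ w hw (hardMean M w Δ) (hardMean_pos hw hΔ)

/-- The hard instance with the mean of arm `m` raised by `δ`. -/
noncomputable def raisedInstance (M K : ℕ) [NeZero M] [NeZero K] (σ : ℝ≥0) (hw : 0 < w)
    (hΔ : 0 < Δ) (m : Fin M) {δ : ℝ} (hδ : 0 < δ) : Instance M K σ :=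
  gaussianInstance σ w hw (Function.update (hardMean M w Δ) m (hardMean M w Δ m + δ))
    (update_hardMean_pos hw hΔ m hδ)

theorem utility_hardInstance (hw : 0 < w) (hΔ : 0 < Δ) (a : Action M K) :
    (hardInstance M K σ hw hΔ).utility a = ((w * K + Δ * playCount a 0 : ℝ) : EReal) := by
  rw [hardInstance, utility_gaussianInstance]
  congr 1
  have : ∀ m, hardMean M w Δ m * playCount a m =
      playCount a m + if m = 0 then Δ / w * playCount a m else 0 := by
    intro m
    unfold hardMean
    split_ifs <;> ring
  simp_rw [this]
  rw [Finset.sum_add_distrib, sum_playCount, Finset.sum_ite_eq' Finset.univ (0 : Fin M)]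
  simp
  field_simp

theorem utility_raisedInstance (hw : 0 < w) (hΔ : 0 < Δ) (m : Fin M) {δ : ℝ} (hδ : 0 < δ)
    (a : Action M K) :
    (raisedInstance M K σ hw hΔ m hδ).utility a =
      ((w * K + Δ * playCount a 0 + w * δ * playCount a m : ℝ) : EReal) := by
  have h0 := utility_hardInstance σ hw hΔ a
  rw [hardInstance, utility_gaussianInstance, EReal.coe_eq_coe_iff] at h0
  rw [raisedInstance, utility_gaussianInstance, ← h0]
  congr 1
  have : ∀ i, Function.update (hardMean M w Δ) m (hardMean M w Δ m + δ) i * playCount a i =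
      hardMean M w Δ i * playCount a i + if i = m then δ * playCount a i else 0 := by
    intro i
    by_cases h : i = m
    · subst h
      simp
      ring
    · simp [h]
  simp_rw [this]
  rw [Finset.sum_add_distrib, Finset.sum_ite_eq' Finset.univ m]
  simp
  ring

theorem optUtility_hardInstance (hw : 0 < w) (hΔ : 0 < Δ) :
    (hardInstance M K σ hw hΔ).optUtility = ((w * K + Δ * K : ℝ) : EReal) := by
  refine Instance.optUtility_eq _ (utility_hardInstance σ hw hΔ) (a₀ := fun _ => 0) ?_ fun a => ?_
  · simp [playCount_const]
  · have := mul_le_mul_of_nonneg_left (playCount_le a 0) hΔ.le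
    linarith

theorem optUtility_raisedInstance (hw : 0 < w) (hΔ : 0 < Δ) {m : Fin M} (hm : m ≠ 0) {δ : ℝ}
    (hδ : 0 < δ) (hδΔ : Δ < w * δ) :
    (raisedInstance M K σ hw hΔ m hδ).optUtility = ((w * K + w * δ * K : ℝ) : EReal) := by
  refine Instance.optUtility_eq _ (utility_raisedInstance σ hw hΔ m hδ) (a₀ := fun _ => m) ?_
    fun a => (raised_utility_le hΔ hm a).trans ?_
  · simp [playCount_const, hm]
  · nlinarith [playCount_le a m]

theorem hardInstance_mem_gapClass (hM : 2 ≤ M) (hw : 0 < w) (hΔ : 0 < Δ) :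
    hardInstance M K σ hw hΔ ∈ gapClass M K σ Δ := by
  have h10 : (⟨1, hM⟩ : Fin M) ≠ 0 := by simp [Fin.ext_iff]
  refine Instance.utilityGap_eq _ (utility_hardInstance σ hw hΔ) hΔ (U := w * K + Δ * K)
    (a₀ := fun _ => 0) (a₁ := Function.update (fun _ => 0) 0 ⟨1, hM⟩) ?_ ?_ fun a => ?_
  · simp [playCount_const]
  · simp [playCount_update, playCount_const, h10]
    ring
  · refine (playCount_eq_or_le a 0).imp (fun h => by rw [h]) fun h => ?_
    nlinarith

/-- Raising the mean by twice the gap makes the raised arm the best one and keeps the gap. -/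
theorem raisedInstance_mem_gapClass (hw : 0 < w) (hΔ : 0 < Δ) {m : Fin M} (hm : m ≠ 0) {δ : ℝ}
    (hδ : 0 < δ) (hδΔ : w * δ = 2 * Δ) :
    raisedInstance M K σ hw hΔ m hδ ∈ gapClass M K σ Δ := by
  refine Instance.utilityGap_eq _ (utility_raisedInstance σ hw hΔ m hδ) hΔ
    (U := w * K + w * δ * K) (a₀ := fun _ => m) (a₁ := Function.update (fun _ => m) 0 0)
    ?_ ?_ fun a => ?_
  · simp [playCount_const, hm]
  · simp [playCount_update, playCount_const, hm, hm.symm, hδΔ]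
    ring
  · have h1 := playCount_add_le a hm
    have h2 := playCount_nonneg a 0
    rw [hδΔ]
    refine (playCount_eq_or_le a m).imp (fun h => ?_) fun h => ?_
    · have : playCount a 0 = 0 := by linarith
      rw [h, this]
      ring
    · nlinarith

end Hard

/-! ### The trade-off between the two regrets -/

section TradeOff

variable {M K : ℕ} [NeZero M] [NeZero K]

/-- The expected number of plays on arm `m` in the first `T` rounds. -/
noncomputable def expectedCount {σ : ℝ≥0} (I : Instance M K σ) (π : Policy M K) (m : Fin M)
    (T : ℕ) : ℝ :=
  ∫ ω, ∑ t ∈ Finset.range T, playCount (ω t).1 m ∂processLaw I π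

theorem regret_hardInstance (A : Algorithm M K) (σ : ℝ≥0) {w Δ : ℝ} (hw : 0 < w) (hΔ : 0 < Δ)
    (T : ℕ) : regret A (hardInstance M K σ hw hΔ) T =
      ENNReal.ofReal (Δ * ∑ m ∈ Finset.univ.erase 0, expectedCount (hardInstance M K σ hw hΔ)
        (A (hardInstance M K σ hw hΔ).toPublicData) m T) := by
  set I := hardInstance M K σ hw hΔ
  set π := A I.toPublicData
  have hsum : ∀ a : Action M K, w * K + Δ * K - (w * K + Δ * playCount a 0) =
      Δ * ∑ m ∈ Finset.univ.erase 0, playCount a m := by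
    intro a
    have := Finset.add_sum_erase Finset.univ (playCount a) (Finset.mem_univ 0)
    rw [sum_playCount] at this
    rw [← this]
    ring
  have hint : ∀ m, Integrable (fun ω => ∑ t ∈ Finset.range T, playCount (ω t).1 m)
      (processLaw I π) := fun m =>
    integrable_finsetSum _ fun t _ => integrable_of_action I π (fun a => playCount a m) t
  rw [regret_eq A I (utility_hardInstance σ hw hΔ) (optUtility_hardInstance σ hw hΔ) fun a => ?_]
  · have hre : ∀ ω : ℕ → Round M K, ∑ t ∈ Finset.range T,
        (w * K + Δ * K - (w * K + Δ * playCount (ω t).1 0)) =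
        Δ * ∑ m ∈ Finset.univ.erase 0, ∑ t ∈ Finset.range T, playCount (ω t).1 m := by
      intro ω
      simp_rw [hsum]
      rw [← Finset.mul_sum, Finset.sum_comm]
    simp_rw [hre]
    rw [← ofReal_integral_eq_lintegral_ofReal
      ((integrable_finsetSum _ fun m _ => hint m).const_mul Δ)
      (ae_of_all _ fun ω => mul_nonneg hΔ.le
        (Finset.sum_nonneg fun m _ => Finset.sum_nonneg fun t _ => playCount_nonneg _ m)),
      integral_const_mul, integral_finsetSum _ fun m _ => hint m]
    rfl
  · have := mul_le_mul_of_nonneg_left (playCount_le a 0) hΔ.le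
    linarith

theorem le_regret_hardInstance (A : Algorithm M K) (σ : ℝ≥0) {w Δ : ℝ} (hw : 0 < w) (hΔ : 0 < Δ)
    {m : Fin M} (hm : m ≠ 0) {c : ℝ} (hc : c ≤ Δ) (T : ℕ) :
    ∫⁻ ω, ENNReal.ofReal (c * ∑ t ∈ Finset.range T, playCount (ω t).1 m)
      ∂processLaw (hardInstance M K σ hw hΔ) (A (uniformPublicData M K w hw)) ≤
      regret A (hardInstance M K σ hw hΔ) T := by
  rw [regret_eq A _ (utility_hardInstance σ hw hΔ) (optUtility_hardInstance σ hw hΔ) fun a => ?_]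
  · refine lintegral_mono fun ω => ENNReal.ofReal_le_ofReal ?_
    rw [Finset.mul_sum]
    refine Finset.sum_le_sum fun t _ => ?_
    nlinarith [playCount_add_le (ω t).1 hm, playCount_nonneg (ω t).1 m]
  · have := mul_le_mul_of_nonneg_left (playCount_le a 0) hΔ.le
    linarith

theorem le_regret_raisedInstance (A : Algorithm M K) (σ : ℝ≥0) {w Δ : ℝ} (hw : 0 < w)
    (hΔ : 0 < Δ) {m : Fin M} (hm : m ≠ 0) {δ : ℝ} (hδ : 0 < δ) (hδΔ : Δ < w * δ) {c : ℝ}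
    (hc : c ≤ w * δ - Δ) (T : ℕ) :
    ∫⁻ ω, ENNReal.ofReal (c * (K * T - ∑ t ∈ Finset.range T, playCount (ω t).1 m))
      ∂processLaw (raisedInstance M K σ hw hΔ m hδ) (A (uniformPublicData M K w hw)) ≤
      regret A (raisedInstance M K σ hw hΔ m hδ) T := by
  rw [regret_eq A _ (utility_raisedInstance σ hw hΔ m hδ)
    (optUtility_raisedInstance σ hw hΔ hm hδ hδΔ) fun a => ?_]
  · refine lintegral_mono fun ω => ENNReal.ofReal_le_ofReal ?_
    have : (K : ℝ) * T - ∑ t ∈ Finset.range T, playCount (ω t).1 m =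
        ∑ t ∈ Finset.range T, (K - playCount (ω t).1 m) := by
      rw [Finset.sum_sub_distrib]
      simp
      ring
    rw [this, Finset.mul_sum]
    refine Finset.sum_le_sum fun t _ => ?_
    have h1 := raised_utility_le (w := w) hΔ hm (δ := δ) (ω t).1
    have h2 := mul_le_mul_of_nonneg_right hc (sub_nonneg.2 (playCount_le (ω t).1 m))
    linarith
  · nlinarith [raised_utility_le (w := w) hΔ hm (δ := δ) a, playCount_le a m]

/-- The policy cannot do well on both instances unless it plays arm `m` often enough to tell them
apart. -/
theorem ofReal_le_regret_add_regret (A : Algorithm M K) {σ : ℝ≥0} (hσ : σ ≠ 0) {w Δ : ℝ}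
    (hw : 0 < w) (hΔ : 0 < Δ) {m : Fin M} (hm : m ≠ 0) {δ : ℝ} (hδ : 0 < δ) (hδΔ : Δ < w * δ)
    (n : ℕ) :
    ENNReal.ofReal (min Δ (w * δ - Δ) * K * ((n + 1 : ℕ) : ℝ) / 2 *
      Real.exp (-(δ ^ 2 / (2 * (σ : ℝ) ^ 2)) * expectedCount (hardInstance M K σ hw hΔ)
        (A (uniformPublicData M K w hw)) m (n + 1))) ≤
      regret A (hardInstance M K σ hw hΔ) (n + 1) +
        regret A (raisedInstance M K σ hw hΔ m hδ) (n + 1) := by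
  set I := hardInstance M K σ hw hΔ with hI
  set J := raisedInstance M K σ hw hΔ m hδ with hJ
  set π := A (uniformPublicData M K w hw) with hπ
  set c := min Δ (w * δ - Δ) with hc
  have hc0 : 0 < c := lt_min hΔ (by linarith)
  let ℓ : Round M K → ℝ := roundLLR m w (hardMean M w Δ m) δ σ
  have hℓ : Measurable ℓ := measurable_roundLLR _ _ _ _ _
  have hℓi : ∀ a, Integrable (fun y => ℓ (a, y)) (I.feedbackKernel a) :=
    integrable_roundLLR σ w hw _ (hardMean_pos hw hΔ) m δ
  let L : (ℕ → Round M K) → ℝ := fun ω => ∑ t ∈ Finset.range (n + 1), ℓ (ω t)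
  let G : (ℕ → Round M K) → ℝ := fun ω => ∑ t ∈ Finset.range (n + 1), playCount (ω t).1 m
  have hLm : Measurable L :=
    Finset.measurable_sum _ fun t _ => hℓ.comp (measurable_pi_apply t)
  have hLi : Integrable L (processLaw I π) :=
    integrable_finsetSum _ fun t _ => integrable_processLaw_round I π t hℓ hℓi
  have hGi : Integrable G (processLaw I π) :=
    integrable_finsetSum _ fun t _ => integrable_of_action I π (fun a => playCount a m) t
  have hL : ∫ ω, L ω ∂processLaw I π =
      -(δ ^ 2 / (2 * (σ : ℝ) ^ 2)) * expectedCount I π m (n + 1) := by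
    rw [integral_finsetSum _ fun t _ => integrable_processLaw_round I π t hℓ hℓi, expectedCount,
      integral_finsetSum _ fun t _ => integrable_of_action I π (fun a => playCount a m) t,
      Finset.mul_sum]
    refine Finset.sum_congr rfl fun t _ => ?_
    rw [integral_processLaw_round I π t hℓ hℓi, ← integral_const_mul]
    exact integral_congr_ae (ae_of_all _ fun ω =>
      integral_roundLLR σ w hw _ (hardMean_pos hw hΔ) m δ (ω t).1)
  have hG0 : ∀ ω, 0 ≤ G ω := fun ω => Finset.sum_nonneg fun t _ => playCount_nonneg _ m
  have hGle : ∀ ω, G ω ≤ K * ((n + 1 : ℕ) : ℝ) := by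
    intro ω
    refine (Finset.sum_le_card_nsmul _ _ (K : ℝ) fun t _ => playCount_le _ m).trans_eq ?_
    simp [mul_comm]
  -- The likelihood ratio of the first `n + 1` rounds.
  have hcm : ∀ f : (Finset.Iic n → Round M K) → ℝ≥0∞, Measurable f →
      ∫⁻ ω, f (Preorder.frestrictLe n ω) ∂processLaw J π =
        ∫⁻ ω, ENNReal.ofReal (Real.exp (L ω)) * f (Preorder.frestrictLe n ω) ∂processLaw I π := by
    intro f hf
    rw [lintegral_processLaw_of_density I J π (ρ := fun r => ENNReal.ofReal (Real.exp (ℓ r)))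
      hℓ.exp.ennreal_ofReal (fun a f hf => lintegral_feedbackKernel_shift σ w hw _ _ hσ m δ _ a hf)
      n hf]
    refine lintegral_congr fun ω => ?_
    rw [← ENNReal.ofReal_prod_of_nonneg fun _ _ => (Real.exp_pos _).le, ← Real.exp_sum,
      ← Nat.range_succ_eq_Iic]
  have hone : ∫⁻ ω, ENNReal.ofReal (Real.exp (L ω)) ∂processLaw I π = 1 := by
    have := hcm (fun _ => 1) measurable_const
    simpa using this.symm
  have hexp0 : 0 ≤ᵐ[processLaw I π] fun ω => Real.exp (L ω) :=
    ae_of_all _ fun ω => (Real.exp_pos _).le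
  have hexpi : Integrable (fun ω => Real.exp (L ω)) (processLaw I π) := by
    refine (lintegral_ofReal_ne_top_iff_integrable hLm.exp.aestronglyMeasurable hexp0).1 ?_
    rw [hone]
    exact ENNReal.one_ne_top
  have hexp1 : ∫ ω, Real.exp (L ω) ∂processLaw I π = 1 := by
    rw [integral_eq_lintegral_of_nonneg_ae hexp0 hLm.exp.aestronglyMeasurable, hone,
      ENNReal.toReal_one]
  have hBH := half_exp_integral_le_integral_min _ hLi hexpi hexp1
  rw [hL] at hBH
  have hregI := le_regret_hardInstance A σ hw hΔ hm (min_le_left Δ (w * δ - Δ)) (n + 1)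
  have hregJ := le_regret_raisedInstance A σ hw hΔ hm hδ hδΔ (min_le_right Δ (w * δ - Δ)) (n + 1)
  rw [← hc, ← hπ] at hregI hregJ
  have hJI : ∫⁻ ω, ENNReal.ofReal (c * (K * ((n + 1 : ℕ) : ℝ) - G ω)) ∂processLaw J π =
      ∫⁻ ω, ENNReal.ofReal (Real.exp (L ω)) *
        ENNReal.ofReal (c * (K * ((n + 1 : ℕ) : ℝ) - G ω)) ∂processLaw I π := by
    have hGf : ∀ ω : ℕ → Round M K,
        ∑ i : Finset.Iic n, playCount (Preorder.frestrictLe n ω i).1 m = G ω := by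
      intro ω
      simp only [G, Nat.range_succ_eq_Iic]
      exact Finset.sum_coe_sort (Finset.Iic n) fun t => playCount (ω t).1 m
    have hmeas : Measurable fun x : Finset.Iic n → Round M K =>
        ENNReal.ofReal (c * (K * ((n + 1 : ℕ) : ℝ) - ∑ i, playCount (x i).1 m)) := by
      have : ∀ i, Measurable fun x : Finset.Iic n → Round M K => playCount (x i).1 m := fun i =>
        (measurable_of_countable fun a : Action M K => playCount a m).comp
          (measurable_fst.comp (measurable_pi_apply i))
      fun_prop
    have := hcm _ hmeas
    simpa only [hGf] using this
  refine le_trans ?_ (add_le_add hregI hregJ)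
  change _ ≤ ∫⁻ ω, ENNReal.ofReal (c * G ω) ∂processLaw I π +
    ∫⁻ ω, ENNReal.ofReal (c * (K * ((n + 1 : ℕ) : ℝ) - G ω)) ∂processLaw J π
  rw [hJI, ← lintegral_add_left' (hGi.const_mul c).aestronglyMeasurable.aemeasurable.ennreal_ofReal]
  have hmini : Integrable (fun ω => min 1 (Real.exp (L ω))) (processLaw I π) :=
    (integrable_const 1).inf hexpi
  have hcKT : 0 ≤ c * (K * ((n + 1 : ℕ) : ℝ)) := by positivity
  calc ENNReal.ofReal (c * K * ((n + 1 : ℕ) : ℝ) / 2 *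
        Real.exp (-(δ ^ 2 / (2 * (σ : ℝ) ^ 2)) * expectedCount I π m (n + 1)))
      ≤ ENNReal.ofReal (∫ ω, c * (K * ((n + 1 : ℕ) : ℝ)) * min 1 (Real.exp (L ω))
          ∂processLaw I π) := by
        refine ENNReal.ofReal_le_ofReal ?_
        rw [integral_const_mul]
        have := mul_le_mul_of_nonneg_left hBH hcKT
        linarith
    _ = ∫⁻ ω, ENNReal.ofReal (c * (K * ((n + 1 : ℕ) : ℝ)) * min 1 (Real.exp (L ω)))
          ∂processLaw I π :=
        ofReal_integral_eq_lintegral_ofReal (hmini.const_mul _)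
          (ae_of_all _ fun ω => mul_nonneg hcKT (le_min zero_le_one (Real.exp_pos _).le))
    _ ≤ _ := by
        refine lintegral_mono fun ω => ?_
        have h1 := hG0 ω
        have h2 := sub_nonneg.2 (hGle ω)
        rw [← ENNReal.ofReal_mul (Real.exp_pos _).le,
          ← ENNReal.ofReal_add (mul_nonneg hc0.le h1)
            (mul_nonneg (Real.exp_pos _).le (mul_nonneg hc0.le h2))]
        refine ENNReal.ofReal_le_ofReal ?_
        have h3 := mul_le_mul_of_nonneg_left (min_le_left 1 (Real.exp (L ω)))
          (mul_nonneg hc0.le h1)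
        have h4 := mul_le_mul_of_nonneg_left (min_le_right 1 (Real.exp (L ω)))
          (mul_nonneg hc0.le h2)
        linarith

end TradeOff

/-! ### Consistency and the logarithmic lower bound -/

section Asymptotics

variable {M K : ℕ}

theorem ConsistentOn.eventually_regret_le {σ : ℝ≥0} {A : Algorithm M K}
    {C : Set (Instance M K σ)} (hA : ConsistentOn A C) {I : Instance M K σ} (hI : I ∈ C) {p : ℝ}
    (hp : 0 < p) : ∀ᶠ T : ℕ in atTop, regret A I T ≤ ENNReal.ofReal ((T : ℝ) ^ p / 2) := by
  have h := (hA I hI p hp).eventually_lt_const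
    (ENNReal.ofReal_pos.2 (by norm_num : (0 : ℝ) < 1 / 2))
  filter_upwards [h, eventually_gt_atTop 0] with T hT hT0
  have hpos : (0 : ℝ) < (T : ℝ) ^ p := Real.rpow_pos_of_pos (by exact_mod_cast hT0) p
  rw [ENNReal.div_lt_iff (.inl (ENNReal.ofReal_pos.2 hpos).ne') (.inl ENNReal.ofReal_ne_top),
    ← ENNReal.ofReal_mul (by norm_num)] at hT
  refine hT.le.trans_eq ?_
  congr 1
  ring

variable [NeZero M] [NeZero K]

/-- On the hard instance, each suboptimal arm is eventually played at least
`(1 - 2 * p) * log T / kl` times in expectation, where `kl` is the divergence of the two reward laws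
of the arm. -/
theorem eventually_log_le_expectedCount {σ : ℝ≥0} (hσ : σ ≠ 0) {w Δ : ℝ} (hw : 0 < w)
    (hΔ : 0 < Δ) {m : Fin M} (hm : m ≠ 0) {δ : ℝ} (hδ : 0 < δ) (hδΔ : Δ < w * δ)
    {A : Algorithm M K} {C : Set (Instance M K σ)} (hA : ConsistentOn A C)
    (hI : hardInstance M K σ hw hΔ ∈ C) (hJ : raisedInstance M K σ hw hΔ m hδ ∈ C) {p : ℝ}
    (hp : 0 < p) : ∀ᶠ T : ℕ in atTop, (1 - 2 * p) * Real.log T ≤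
      δ ^ 2 / (2 * (σ : ℝ) ^ 2) * expectedCount (hardInstance M K σ hw hΔ)
        (A (uniformPublicData M K w hw)) m T := by
  set c := min Δ (w * δ - Δ) * K / 2 with hc
  have hK : (0 : ℝ) < K := by exact_mod_cast Nat.pos_of_ne_zero (NeZero.ne K)
  have hc0 : 0 < c := by
    have : 0 < min Δ (w * δ - Δ) := lt_min hΔ (by linarith)
    positivity
  have hlog : Tendsto (fun T : ℕ => p * Real.log T) atTop atTop :=
    (Real.tendsto_log_atTop.comp tendsto_natCast_atTop_atTop).const_mul_atTop hp
  filter_upwards [hA.eventually_regret_le hI hp, hA.eventually_regret_le hJ hp,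
    eventually_gt_atTop 0, hlog.eventually_ge_atTop (-Real.log c)] with T h1 h2 hT0 h3
  obtain ⟨n, rfl⟩ := Nat.exists_eq_succ_of_ne_zero hT0.ne'
  have h4 := (ofReal_le_regret_add_regret A hσ hw hΔ hm hδ hδΔ n).trans (add_le_add h1 h2)
  have hT : (0 : ℝ) < ((n + 1 : ℕ) : ℝ) := by positivity
  have hTp := Real.rpow_pos_of_pos hT p
  rw [← ENNReal.ofReal_add (half_pos hTp).le (half_pos hTp).le, add_halves,
    ENNReal.ofReal_le_ofReal_iff hTp.le] at h4
  set x := expectedCount (hardInstance M K σ hw hΔ) (A (uniformPublicData M K w hw)) m (n + 1)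
  have h5 : c * ((n + 1 : ℕ) : ℝ) * Real.exp (-(δ ^ 2 / (2 * (σ : ℝ) ^ 2)) * x) ≤
      ((n + 1 : ℕ) : ℝ) ^ p := by
    refine le_of_eq_of_le ?_ h4
    rw [hc]
    ring
  have h6 := Real.log_le_log (by positivity) h5
  rw [Real.log_mul (by positivity) (Real.exp_ne_zero _), Real.log_mul hc0.ne' hT.ne', Real.log_exp,
    Real.log_rpow hT] at h6
  change (1 - 2 * p) * Real.log ((n + 1 : ℕ) : ℝ) ≤ δ ^ 2 / (2 * (σ : ℝ) ^ 2) * x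
  change -Real.log c ≤ p * Real.log ((n + 1 : ℕ) : ℝ) at h3
  linarith

theorem ofReal_le_liminf_regret {σ : ℝ≥0} (hσ : σ ≠ 0) {w Δ : ℝ} (hw : 0 < w)
    (hΔ : 0 < Δ) {δ : ℝ} (hδ : 0 < δ) (hδΔ : Δ < w * δ)
    {A : Algorithm M K} {C : Set (Instance M K σ)} (hA : ConsistentOn A C)
    (hI : hardInstance M K σ hw hΔ ∈ C)
    (hJ : ∀ m : Fin M, m ≠ 0 → raisedInstance M K σ hw hΔ m hδ ∈ C) :
    ENNReal.ofReal (Δ * ((M - 1) * (2 * (σ : ℝ) ^ 2 / δ ^ 2))) ≤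
      liminf (fun T : ℕ => regret A (hardInstance M K σ hw hΔ) T / ENNReal.ofReal (Real.log T))
        atTop := by
  have hσ' : (0 : ℝ) < σ := by exact_mod_cast pos_iff_ne_zero.2 hσ
  have hp : ∀ p : ℝ, 0 < p →
      ENNReal.ofReal (Δ * ((M - 1) * ((1 - 2 * p) * (2 * (σ : ℝ) ^ 2 / δ ^ 2)))) ≤
      liminf (fun T : ℕ => regret A (hardInstance M K σ hw hΔ) T / ENNReal.ofReal (Real.log T))
        atTop := by
    intro p hp
    refine le_liminf_of_le (by isBoundedDefault) ?_
    have hall : ∀ᶠ T : ℕ in atTop, ∀ m : Fin M, m ≠ 0 → (1 - 2 * p) * Real.log T ≤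
        δ ^ 2 / (2 * (σ : ℝ) ^ 2) * expectedCount (hardInstance M K σ hw hΔ)
          (A (uniformPublicData M K w hw)) m T :=
      eventually_all.2 fun m => by
        by_cases hm : m = 0
        · exact Eventually.of_forall fun T h => absurd hm h
        · filter_upwards [eventually_log_le_expectedCount hσ hw hΔ hm hδ hδΔ hA hI (hJ m hm) hp]
            with T hT _ using hT
    filter_upwards [hall, eventually_gt_atTop 1] with T hT hT1
    have hlog : 0 < Real.log T := Real.log_pos (by exact_mod_cast hT1)
    rw [ENNReal.le_div_iff_mul_le (.inl (ENNReal.ofReal_pos.2 hlog).ne')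
      (.inl ENNReal.ofReal_ne_top), ← ENNReal.ofReal_mul' hlog.le, regret_hardInstance]
    refine ENNReal.ofReal_le_ofReal ?_
    rw [mul_assoc]
    refine mul_le_mul_of_nonneg_left ?_ hΔ.le
    have hcard : ((Finset.univ.erase (0 : Fin M)).card : ℝ) = M - 1 := by
      rw [Finset.card_erase_of_mem (Finset.mem_univ _), Finset.card_univ, Fintype.card_fin,
        Nat.cast_sub (Nat.one_le_iff_ne_zero.2 (NeZero.ne M)), Nat.cast_one]
    rw [← hcard, mul_assoc, ← nsmul_eq_mul]
    refine Finset.card_nsmul_le_sum _ _ _ fun m hm => ?_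
    have h1 := hT m (Finset.ne_of_mem_erase hm)
    rw [mul_right_comm, mul_div_assoc', div_le_iff₀ (by positivity)]
    rw [div_mul_eq_mul_div, le_div_iff₀ (by positivity)] at h1
    change _ ≤ expectedCount (hardInstance M K σ hw hΔ) (A (uniformPublicData M K w hw)) m T * _
    linarith
  have hlim : Tendsto (fun p : ℝ =>
      ENNReal.ofReal (Δ * ((M - 1) * ((1 - 2 * p) * (2 * (σ : ℝ) ^ 2 / δ ^ 2))))) (𝓝[>] 0)
      (𝓝 (ENNReal.ofReal (Δ * ((M - 1) * ((1 - 2 * 0) * (2 * (σ : ℝ) ^ 2 / δ ^ 2)))))) := by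
    refine ENNReal.tendsto_ofReal (Continuous.tendsto' ?_ _ _ rfl |>.mono_left nhdsWithin_le_nhds)
    fun_prop
  rw [mul_zero, sub_zero, one_mul] at hlim
  exact le_of_tendsto hlim (eventually_mem_nhdsWithin.mono hp)

end Asymptotics
end MSBPRS

theorem theorem2 (M K : ℕ) [NeZero K] (hM : 2 ≤ M) (σ : ℝ≥0) (Δ : ℝ) (hΔ : 0 < Δ) :
    (∀ w : ℝ, 4 ≤ w →
      ∃ I ∈ MSBPRS.gapClass M K σ Δ, I.weight 0 = w ∧
        ∀ A : MSBPRS.Algorithm M K, MSBPRS.ConsistentOn A (MSBPRS.gapClass M K σ Δ) →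
          ENNReal.ofReal (I.weight 0 * (σ : ℝ) ^ 2 * (M / Δ)) ≤
            liminf (fun T : ℕ => MSBPRS.regret A I T / ENNReal.ofReal (Real.log T)) atTop) ∧
    (∀ w : ℝ, 1 ≤ w →
      ∃ I ∈ MSBPRS.gapClass M K σ Δ, I.weight 0 = w ∧
        ∀ A : MSBPRS.Algorithm M K,
          MSBPRS.ConsistentOn A (Set.univ : Set (MSBPRS.Instance M K σ)) →
          ENNReal.ofReal (I.weight 0 * (σ : ℝ) ^ 2 * (M / Δ)) ≤
            liminf (fun T : ℕ => MSBPRS.regret A I T / ENNReal.ofReal (Real.log T)) atTop) := by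
  have : NeZero M := ⟨by omega⟩
  have hM' : (2 : ℝ) ≤ M := by exact_mod_cast hM
  refine ⟨fun w hw => ?_, fun w hw => ?_⟩
  · have hw0 : 0 < w := by linarith
    have hmem := MSBPRS.hardInstance_mem_gapClass (K := K) σ hM hw0 hΔ
    refine ⟨MSBPRS.hardInstance M K σ hw0 hΔ, hmem, rfl, fun A hA => ?_⟩
    change ENNReal.ofReal (w * (σ : ℝ) ^ 2 * (M / Δ)) ≤ _
    rcases eq_or_ne σ 0 with rfl | hσ
    · simp
    have hδ : 0 < 2 * Δ / w := by positivity
    have hδw : w * (2 * Δ / w) = 2 * Δ := by field_simp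
    refine le_trans (ENNReal.ofReal_le_ofReal ?_) (MSBPRS.ofReal_le_liminf_regret hσ hw0 hΔ hδ
      (by linarith) hA hmem fun m hm =>
        MSBPRS.raisedInstance_mem_gapClass σ hw0 hΔ hm hδ hδw)
    -- The bound is `w ^ 2 * σ ^ 2 * (M - 1) / (2 * Δ)`, and `w * (M - 1) ≥ 4 * (M / 2)`.
    have h : Δ * ((M - 1) * (2 * (σ : ℝ) ^ 2 / (2 * Δ / w) ^ 2)) =
        w * (σ : ℝ) ^ 2 * ((w * (M - 1) / 2) / Δ) := by
      field_simp
    rw [h]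
    gcongr
    nlinarith
  · have hw0 : 0 < w := by linarith
    have hmem := MSBPRS.hardInstance_mem_gapClass (K := K) σ hM hw0 hΔ
    refine ⟨MSBPRS.hardInstance M K σ hw0 hΔ, hmem, rfl, fun A hA => ?_⟩
    change ENNReal.ofReal (w * (σ : ℝ) ^ 2 * (M / Δ)) ≤ _
    rcases eq_or_ne σ 0 with rfl | hσ
    · simp
    -- The alternatives may have an arbitrarily small gap `w * ε`.
    have hε : ∀ ε : ℝ, 0 < ε →
        ENNReal.ofReal (Δ * ((M - 1) * (2 * (σ : ℝ) ^ 2 / (Δ / w + ε) ^ 2))) ≤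
          liminf (fun T : ℕ => MSBPRS.regret A (MSBPRS.hardInstance M K σ hw0 hΔ) T /
            ENNReal.ofReal (Real.log T)) atTop := fun ε hε => by
      have hδw : w * (Δ / w + ε) = Δ + w * ε := by field_simp
      have : 0 < w * ε := by positivity
      exact MSBPRS.ofReal_le_liminf_regret hσ hw0 hΔ (by positivity) (by linarith) hA trivial
        fun m hm => trivial
    have hlim : Tendsto (fun ε : ℝ =>
        ENNReal.ofReal (Δ * ((M - 1) * (2 * (σ : ℝ) ^ 2 / (Δ / w + ε) ^ 2)))) (𝓝[>] 0)
        (𝓝 (ENNReal.ofReal (Δ * ((M - 1) * (2 * (σ : ℝ) ^ 2 / (Δ / w + 0) ^ 2))))) := by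
      refine ENNReal.tendsto_ofReal (ContinuousAt.tendsto ?_ |>.mono_left nhdsWithin_le_nhds)
      have : (Δ / w + 0) ^ 2 ≠ 0 := by
        rw [add_zero]
        positivity
      fun_prop (disch := assumption)
    refine le_trans (ENNReal.ofReal_le_ofReal ?_)
      (le_of_tendsto hlim (eventually_mem_nhdsWithin.mono hε))
    have h : Δ * ((M - 1) * (2 * (σ : ℝ) ^ 2 / (Δ / w + 0) ^ 2)) =
        w * (σ : ℝ) ^ 2 * ((w * (2 * (M - 1))) / Δ) := by
      rw [add_zero]
      field_simp
    rw [h]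
    gcongr
    nlinarith
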